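/- Let $1\le r\le n$ and let $A$ and $X$ be $n\times n$ complex matrices. For an $n\times n$ complex matrix $B$, define $g_1(B),\dots,g_n(B)$ by $$\det(xI-B)=x^n-g_1(B)x^{n-1}+g_2(B)x^{n-2}-\cdots+(-1)^n g_n(B).$$ Let $Q_{r,n}$ be the set of tuples $\mathcal I=(i_1,\dots,i_r)$ with $1\le i_1<\cdots<i_r\le n$, and let $A_{\mathcal I}$ be the $r\times r$ principal submatrix of $A$ with rows and columns $i_1,\dots,i_r$. Let $s_1(A_{\mathcal I})\ge\cdots\ge s_r(A_{\mathcal I})$ be the singular values of $A_{\mathcal I}$, counted with multiplicity, let $p_j(x_1,\dots,x_r)$ be the $j$th elementary symmetric polynomial in $r$ variables, with $p_0=1$, and let $\|X\|$ be the operator norm of $X$ with respect to the Euclidean norm on $\mathbb C^n$, that is, its largest singular value. Then $$|g_r(A+X)-g_r(A)|\le\sum_{\mathcal I\in Q_{r,n}}\ \sum_{k=1}^{r}p_{r-k}\bigl(s_1(A_{\mathcal I}),\dots,s_r(A_{\mathcal I})\bigr)\,\|X\|^k.$$ -/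

import Mathlib

/- Matrices carry the operator norm induced by the Euclidean norm on `ℂⁿ`
(that is, the largest singular value). -/
open scoped Matrix.Norms.L2Operator

namespace CharCoeff

/-- The signed coefficient `g_r` of the characteristic polynomial:
`det (x - A) = x ^ n - g_1(A) x ^ (n - 1) + g_2(A) x ^ (n - 2) - ⋯ + (-1) ^ n g_n(A)`.
It is meant for `r ≤ n`. -/
noncomputable def g {n : ℕ} (r : ℕ) (A : Matrix (Fin n) (Fin n) ℂ) : ℂ :=
  (-1) ^ r * A.charpoly.coeff (n - r)

/-- `Q r n` is the set of strictly increasing `r`-tuples of indices in `{1, …, n}`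
(here indexed from zero). -/
abbrev Q (r n : ℕ) : Type := Fin r ↪o Fin n

/-- The principal submatrix of `A` whose rows and columns are those indexed by `I`. -/
def principalSubmatrix {n r : ℕ} (A : Matrix (Fin n) (Fin n) ℂ) (I : Q r n) :
    Matrix (Fin r) (Fin r) ℂ :=
  A.submatrix I I

/-- The singular values `s_1(B) ≥ ⋯ ≥ s_r(B)` of an `r × r` matrix
(indexed from zero). -/
noncomputable def s {r : ℕ} (B : Matrix (Fin r) (Fin r) ℂ) : Fin r → ℝ :=
  fun i => (Matrix.toEuclideanLin B).singularValues i

/-- The `j`-th elementary symmetric polynomial in `r` variables, evaluated at `x`;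
`p 0 x = 1`. -/
noncomputable def p {r : ℕ} (j : ℕ) (x : Fin r → ℝ) : ℝ :=
  MvPolynomial.eval x (MvPolynomial.esymm (Fin r) ℝ j)

end CharCoeff

/-! Since `g r` is the sum of the `r × r` principal minors, the triangle inequality reduces the
claim to bounding `det (B + Y) - det B` with `B = A_I`, `Y = X_I` and `‖Y‖ ≤ ‖X‖`. By the singular
value decomposition, unitary factors (determinant of modulus 1) turn `B` into `D = diag(s_i)` and
`Y` into some `Z` with `‖Z‖ ≤ ‖Y‖`. Expanding `det (D + Z)` over index sets `S` gives `∏_{i ∈ S}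
s_i` times the complementary minor of `Z`, at most `‖Y‖ ^ (r - #S)` in modulus. The full set gives
`det D`, which cancels; the sets of size `r - k` add up to `p (r - k)`. -/

namespace Matrix

open Finset

section Expansion

variable {m R : Type*} [Fintype m] [DecidableEq m] [CommRing R]

/-- Replacing the rows indexed by `S` by those of a diagonal matrix factors out the
diagonal entries and leaves the complementary principal minor. -/
theorem det_piecewise_diagonal (d : m → R) (Z : Matrix m m R) (S : Finset m) :
    det (Matrix.of fun i j => if i ∈ S then diagonal d i j else Z i j) =
      (∏ i ∈ S, d i) * (Z.submatrix ((↑) : {i // i ∉ S} → m) (↑)).det := by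
  set M : Matrix m m R := Matrix.of fun i j => if i ∈ S then diagonal d i j else Z i j with hM
  have h1 : (M.toSquareBlockProp (fun i => i ∈ S)).det = ∏ i ∈ S, d i := by
    have : M.toSquareBlockProp (fun i => i ∈ S) = diagonal (fun i : {i // i ∈ S} => d i) := by
      ext i j
      rw [toSquareBlockProp_def, of_apply, hM, of_apply, if_pos i.2]
      simp only [diagonal_apply, Subtype.ext_iff]
    rw [this]
    exact det_diagonal.trans (prod_subtype S (fun _ => Iff.rfl) d).symm
  have h2 : M.toSquareBlockProp (fun i => i ∉ S) = Z.submatrix (↑) (↑) := by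
    ext i j
    rw [toSquareBlockProp_def, of_apply, hM, of_apply, if_neg i.2, submatrix_apply]
  have h3 : ∀ i, i ∈ S → ∀ j, j ∉ S → M i j = 0 := fun i hi j hj => by
    rw [hM, of_apply, if_pos hi, diagonal_apply_ne _ (ne_of_mem_of_not_mem hi hj)]
  rw [← h1, ← h2]
  convert twoBlockTriangular_det' M (fun i => i ∈ S) h3

/-- The determinant of `diagonal d + Z` expanded along principal minors of `Z`. -/
theorem det_diagonal_add (d : m → R) (Z : Matrix m m R) :
    (diagonal d + Z).det =
      ∑ S : Finset m, (∏ i ∈ S, d i) * (Z.submatrix ((↑) : {i // i ∉ S} → m) (↑)).det := by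
  simp_rw [← det_piecewise_diagonal]
  refine ((detRowAlternating (n := m) (R := R)).toMultilinearMap.map_add_univ
    (diagonal d) Z).trans (sum_congr rfl fun S _ => ?_)
  refine congrArg (det (R := R)) (funext fun i => ?_)
  by_cases hi : i ∈ S
  · exact (S.piecewise_eq_of_mem _ _ hi).trans (funext fun j => (if_pos hi).symm)
  · exact (S.piecewise_eq_of_notMem _ _ hi).trans (funext fun j => (if_neg hi).symm)

/-- The coefficients of the characteristic polynomial are signed sums of principal minors. -/
theorem charpoly_coeff_card_sub (A : Matrix m m R) {r : ℕ} (hr : r ≤ Fintype.card m) :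
    A.charpoly.coeff (Fintype.card m - r) =
      (-1) ^ r * ∑ T ∈ powersetCard r (univ : Finset m),
        (A.submatrix ((↑) : {i // i ∈ T} → m) (↑)).det := by
  have hchar : A.charmatrix = diagonal (fun _ => Polynomial.X) + (-A).map Polynomial.C := by
    ext i j
    simp [charmatrix_apply, sub_eq_add_neg]
  -- The minor is a constant polynomial, so `S` contributes `X ^ #S` only: the coefficient selects
  -- the sets whose complement has size `r`.
  have hterm (S : Finset m) :
      ((∏ _i ∈ S, (Polynomial.X : Polynomial R)) *
        (((-A).map Polynomial.C).submatrix ((↑) : {i // i ∉ S} → m) (↑)).det).coeff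
          (Fintype.card m - r) =
      if Sᶜ ∈ powersetCard r (univ : Finset m) then
        (-1) ^ r * (A.submatrix ((↑) : {i // i ∈ Sᶜ} → m) (↑)).det else 0 := by
    have hC : (((-A).map Polynomial.C).submatrix ((↑) : {i // i ∉ S} → m) (↑)).det =
        Polynomial.C ((-1) ^ #Sᶜ * (A.submatrix ((↑) : {i // i ∈ Sᶜ} → m) (↑)).det) := by
      have he : (A.submatrix ((↑) : {i // i ∈ Sᶜ} → m) (↑)).det =
          (A.submatrix ((↑) : {i // i ∉ S} → m) (↑)).det := by
        rw [← det_submatrix_equiv_self (Equiv.subtypeEquivRight (fun i => mem_compl (s := S)))]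
        rfl
      have hcard : #Sᶜ = Fintype.card {i // i ∉ S} := by
        rw [Fintype.card_of_subtype Sᶜ (fun i => mem_compl)]
      rw [he, hcard, ← det_neg, RingHom.map_det]
      rfl
    rw [hC, prod_const, mul_comm, Polynomial.coeff_C_mul, Polynomial.coeff_X_pow]
    have hmem : Sᶜ ∈ powersetCard r (univ : Finset m) ↔ Fintype.card m - #S = r := by
      rw [mem_powersetCard_univ, card_compl]
    have := card_le_univ S
    by_cases h : Fintype.card m - r = #S
    · rw [if_pos h, if_pos (hmem.2 (by omega)), mul_one, card_compl, hmem.1 (hmem.2 (by omega))]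
    · rw [if_neg h, if_neg (fun h' => h (by have := hmem.1 h'; omega)), mul_zero]
  rw [charpoly, hchar, det_diagonal_add, Polynomial.finsetSum_coeff, sum_congr rfl
    (fun S _ => hterm S), mul_sum, (compl_involutive (α := Finset m)).bijective.sum_comp
      (fun T => if T ∈ powersetCard r (univ : Finset m) then
        (-1) ^ r * (A.submatrix ((↑) : {i // i ∈ T} → m) (↑)).det else 0), sum_ite_mem, univ_inter]

end Expansion

section Norm

variable {l m : Type*} [Fintype l] [DecidableEq l] [Fintype m] [DecidableEq m]

/-- The columns are orthonormal, so the C*-identity applies. Equality fails when `l` is empty. -/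
theorem l2_opNorm_one_submatrix_le {e : l → m} (he : Function.Injective e) :
    ‖(1 : Matrix m m ℂ).submatrix id e‖ ≤ 1 := by
  have h : ((1 : Matrix m m ℂ).submatrix id e)ᴴ * (1 : Matrix m m ℂ).submatrix id e =
      diagonal (fun _ => 1) := by
    ext i j
    simp [mul_apply, one_apply, diagonal_apply, he.eq_iff, eq_comm]
  have h1 := l2_opNorm_conjTranspose_mul_self ((1 : Matrix m m ℂ).submatrix id e)
  rw [h, l2_opNorm_diagonal] at h1
  have h2 : ‖(fun _ : l => (1 : ℂ))‖ ≤ 1 := (pi_norm_le_iff_of_nonneg zero_le_one).2 (by simp)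
  nlinarith [norm_nonneg ((1 : Matrix m m ℂ).submatrix id e)]

/-- Principal submatrices do not increase the operator norm. -/
theorem l2_opNorm_submatrix_le (Z : Matrix m m ℂ) {e : l → m} (he : Function.Injective e) :
    ‖Z.submatrix e e‖ ≤ ‖Z‖ := by
  set P := (1 : Matrix m m ℂ).submatrix id e with hP
  have hZ : Z.submatrix e e = Pᴴ * (Z * P) := by
    ext i j
    simp [hP, mul_apply, one_apply]
  have hP1 : ‖P‖ ≤ 1 := l2_opNorm_one_submatrix_le he
  calc ‖Z.submatrix e e‖ ≤ ‖Pᴴ‖ * ‖Z * P‖ := hZ ▸ l2_opNorm_mul _ _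
    _ ≤ ‖Pᴴ‖ * (‖Z‖ * ‖P‖) := by gcongr; exact l2_opNorm_mul _ _
    _ ≤ 1 * (‖Z‖ * 1) := by rw [l2_opNorm_conjTranspose]; gcongr
    _ = ‖Z‖ := by ring

theorem l2_opNorm_le_one_of_mem_unitaryGroup {U : Matrix m m ℂ} (hU : U ∈ unitaryGroup m ℂ) :
    ‖U‖ ≤ 1 := by
  have h1 := l2_opNorm_conjTranspose_mul_self U
  rw [← star_eq_conjTranspose, mem_unitaryGroup_iff'.1 hU, ← diagonal_one,
    l2_opNorm_diagonal] at h1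
  have h2 : ‖(fun _ : m => (1 : ℂ))‖ ≤ 1 := (pi_norm_le_iff_of_nonneg zero_le_one).2 (by simp)
  have h3 : ‖U‖ * ‖U‖ ≤ 1 := h1 ▸ h2
  nlinarith [norm_nonneg U]

theorem norm_det_of_mem_unitaryGroup {U : Matrix m m ℂ} (hU : U ∈ unitaryGroup m ℂ) :
    ‖U.det‖ = 1 :=
  CStarRing.norm_of_mem_unitary (det_of_mem_unitary hU)

/-- The determinant is the product of the eigenvalues, each bounded by the operator norm. -/
theorem norm_det_le_l2_opNorm_pow (Z : Matrix m m ℂ) : ‖Z.det‖ ≤ ‖Z‖ ^ Fintype.card m := by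
  cases isEmpty_or_nonempty m
  · simp
  rw [det_eq_prod_roots_charpoly, ← Z.charpoly_natDegree_eq_dim,
    ← (IsAlgClosed.splits Z.charpoly).natDegree_eq_card_roots.symm]
  have hle : ∀ μ ∈ Z.charpoly.roots, ‖μ‖ ≤ ‖Z‖ := fun μ hμ =>
    spectrum.norm_le_norm_of_mem
      (mem_spectrum_iff_isRoot_charpoly.2 (Polynomial.isRoot_of_mem_roots hμ))
  generalize Z.charpoly.roots = M at hle
  induction M using Multiset.induction_on with
  | empty => simp
  | cons a M ih =>
    rw [Multiset.prod_cons, norm_mul, Multiset.card_cons, pow_succ']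
    exact mul_le_mul (hle a (Multiset.mem_cons_self a M))
      (ih fun μ hμ => hle μ (Multiset.mem_cons_of_mem hμ)) (norm_nonneg _) (norm_nonneg _)

end Norm

end Matrix

namespace CharCoeff

open Matrix Finset

theorem s_nonneg {r : ℕ} (B : Matrix (Fin r) (Fin r) ℂ) (i : Fin r) : 0 ≤ s B i :=
  LinearMap.singularValues_nonneg _ _

theorem p_eq_sum_prod {r : ℕ} (j : ℕ) (x : Fin r → ℝ) :
    p j x = ∑ S ∈ powersetCard j (univ : Finset (Fin r)), ∏ i ∈ S, x i := by
  simp [p, MvPolynomial.esymm]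

/-- Singular value decomposition of a square complex matrix. -/
theorem exists_unitary_mul_eq_mul_diagonal {r : ℕ} (B : Matrix (Fin r) (Fin r) ℂ) :
    ∃ U ∈ unitaryGroup (Fin r) ℂ, ∃ V ∈ unitaryGroup (Fin r) ℂ,
      B * V = U * diagonal (fun i => (s B i : ℂ)) := by
  set T := toEuclideanLin B with hT
  have hn : Module.finrank ℂ (EuclideanSpace ℂ (Fin r)) = r := by simp
  have hsym := T.isSymmetric_adjoint_comp_self
  set v := hsym.eigenvectorBasis hn with hv
  -- The `v i` are eigenvectors of `T* T`, so their images are orthogonal, of length `s B i`.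
  have hinner (i j : Fin r) : inner ℂ (T (v i)) (T (v j)) =
      ((s B j : ℂ)) ^ 2 * inner ℂ (v i) (v j) := by
    have h := hsym.apply_eigenvectorBasis hn j
    rw [← hv] at h
    rw [← LinearMap.adjoint_inner_right, ← LinearMap.comp_apply, h, inner_smul_right,
      ← T.sq_singularValues_fin hn]
    simp [s, hT]
  have horth : Pairwise fun i j => inner ℂ (T (v i)) (T (v j)) = 0 := fun i j hij => by
    beta_reduce
    rw [hinner, v.orthonormal.2 hij, mul_zero]
  have hnorm (i : Fin r) : ‖T (v i)‖ = s B i := by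
    have h := hinner i i
    rw [inner_self_eq_norm_sq_to_K, inner_self_eq_norm_sq_to_K, v.norm_eq_one] at h
    have h' : ‖T (v i)‖ ^ 2 = s B i ^ 2 := by
      have : ((‖T (v i)‖ ^ 2 : ℝ) : ℂ) = ((s B i ^ 2 : ℝ) : ℂ) := by simpa using h
      exact_mod_cast this
    exact (sq_eq_sq₀ (norm_nonneg _) (s_nonneg B i)).1 h'
  -- Gram–Schmidt merely normalizes the nonzero `T (v i)`; where `T (v i) = 0`, any completion to an
  -- orthonormal basis serves.
  set u := InnerProductSpace.gramSchmidtOrthonormalBasis (𝕜 := ℂ)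
    (by simp : Module.finrank ℂ (EuclideanSpace ℂ (Fin r)) = Fintype.card (Fin r))
    (fun i => T (v i)) with hu
  have huv (i : Fin r) : T (v i) = (s B i : ℂ) • u i := by
    by_cases h0 : T (v i) = 0
    · have : s B i = 0 := by rw [← hnorm, h0, norm_zero]
      rw [h0, this]; simp
    · rw [hu, InnerProductSpace.gramSchmidtOrthonormalBasis_apply_of_orthogonal _ horth h0, hnorm,
        smul_smul]
      have : (s B i : ℂ) ≠ 0 := by
        rw [← hnorm]; exact_mod_cast norm_ne_zero_iff.2 h0
      simp [this]
  let b := EuclideanSpace.basisFun (Fin r) ℂ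
  refine ⟨b.toBasis.toMatrix u, b.toMatrix_orthonormalBasis_mem_unitary u,
    b.toBasis.toMatrix v, b.toMatrix_orthonormalBasis_mem_unitary v, ?_⟩
  ext i j
  have h := congrArg (fun w : EuclideanSpace ℂ (Fin r) => w i) (huv j)
  simp only [hT, toLpLin_apply, PiLp.smul_apply, smul_eq_mul] at h
  rw [mul_diagonal, mul_comm]
  simpa [b, Matrix.mul_apply, Module.Basis.toMatrix_apply, mulVec, dotProduct] using h

/-- Perturbation bound for determinants in terms of singular values. -/
theorem norm_det_add_sub_det_le {r : ℕ} (B Y : Matrix (Fin r) (Fin r) ℂ) :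
    ‖(B + Y).det - B.det‖ ≤ ∑ k ∈ Icc 1 r, p (r - k) (s B) * ‖Y‖ ^ k := by
  obtain ⟨U, hU, V, hV, hB⟩ := exists_unitary_mul_eq_mul_diagonal B
  set D : Matrix (Fin r) (Fin r) ℂ := diagonal (fun i => (s B i : ℂ)) with hD
  set Z := star U * (Y * V) with hZdef
  have hUZ : Y * V = U * Z := by
    rw [hZdef, ← Matrix.mul_assoc, mem_unitaryGroup_iff.1 hU, Matrix.one_mul]
  have hZ : ‖Z‖ ≤ ‖Y‖ := by
    calc ‖Z‖ ≤ ‖star U‖ * (‖Y‖ * ‖V‖) :=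
          (l2_opNorm_mul _ _).trans (by gcongr; exact l2_opNorm_mul _ _)
      _ ≤ 1 * (‖Y‖ * 1) := by
          gcongr
          · exact l2_opNorm_le_one_of_mem_unitaryGroup (Unitary.star_mem hU)
          · exact l2_opNorm_le_one_of_mem_unitaryGroup hV
      _ = ‖Y‖ := by ring
  have hdet : ((B + Y).det - B.det) * V.det = U.det * ((D + Z).det - D.det) := by
    rw [sub_mul, ← det_mul, ← det_mul, Matrix.add_mul, hB, hUZ, ← Matrix.mul_add, det_mul, det_mul,
      mul_sub]
  have hnorm : ‖(B + Y).det - B.det‖ = ‖(D + Z).det - D.det‖ := by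
    have := congrArg norm hdet
    rwa [norm_mul, norm_mul, norm_det_of_mem_unitaryGroup hU, norm_det_of_mem_unitaryGroup hV,
      mul_one, one_mul] at this
  have hterm (S : Finset (Fin r)) :
      ‖(∏ i ∈ S, (s B i : ℂ)) * (Z.submatrix ((↑) : {i // i ∉ S} → Fin r) (↑)).det‖ ≤
        (∏ i ∈ S, s B i) * ‖Y‖ ^ (r - #S) := by
    have hcard : Fintype.card {i // i ∉ S} = r - #S := by
      rw [Fintype.card_of_subtype Sᶜ (fun i => mem_compl), card_compl, Fintype.card_fin]
    rw [norm_mul, norm_prod, ← hcard]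
    have h1 : ∏ i ∈ S, ‖(s B i : ℂ)‖ = ∏ i ∈ S, s B i :=
      prod_congr rfl fun i _ => by simp [abs_of_nonneg (s_nonneg B i)]
    rw [h1]
    refine mul_le_mul_of_nonneg_left ?_ (prod_nonneg fun i _ => s_nonneg B i)
    exact (norm_det_le_l2_opNorm_pow _).trans (pow_le_pow_left₀ (norm_nonneg _)
      ((l2_opNorm_submatrix_le Z Subtype.val_injective).trans hZ) _)
  have hfull : (∏ i ∈ univ, (s B i : ℂ)) *
      (Z.submatrix ((↑) : {i // i ∉ (univ : Finset (Fin r))} → Fin r) (↑)).det = D.det := by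
    have : IsEmpty {i // i ∉ (univ : Finset (Fin r))} := ⟨fun i => i.2 (mem_univ _)⟩
    rw [det_isEmpty, mul_one, hD, det_diagonal]
  rw [hnorm, hD, det_diagonal_add, ← hD, ← add_sum_erase _ _ (mem_univ (univ : Finset (Fin r))),
    hfull, add_sub_cancel_left]
  calc _ ≤ ∑ S ∈ univ.erase (univ : Finset (Fin r)), (∏ i ∈ S, s B i) * ‖Y‖ ^ (r - #S) :=
        norm_sum_le_of_le _ fun S _ => hterm S
    _ = ∑ k ∈ Icc 1 r, p (r - k) (s B) * ‖Y‖ ^ k := by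
      -- Removing the full set is what makes `k = r - #S` start at 1.
      have hmaps : ∀ S ∈ univ.erase (univ : Finset (Fin r)), r - #S ∈ Icc 1 r := fun S hS => by
        have : #S < r := by
          simpa using card_lt_univ_of_notMem
            (not_forall.1 fun h => (mem_erase.1 hS).1 (eq_univ_iff_forall.2 h)).choose_spec
        simp only [mem_Icc]; omega
      rw [← sum_fiberwise_of_maps_to hmaps]
      refine sum_congr rfl fun k hk => ?_
      rw [p_eq_sum_prod, sum_mul]
      have hk' := mem_Icc.1 hk
      have hset : {S ∈ univ.erase (univ : Finset (Fin r)) | r - #S = k} =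
          powersetCard (r - k) univ := by
        ext S
        have hc : #S ≤ r := by simpa using card_le_univ S
        simp only [mem_filter, mem_erase, mem_univ, and_true, mem_powersetCard, subset_univ,
          true_and]
        constructor
        · rintro ⟨-, h⟩; omega
        · intro h
          refine ⟨?_, by omega⟩
          rintro rfl
          simp at h; omega
      rw [hset]
      refine sum_congr rfl fun S hS => ?_
      rw [(mem_powersetCard.1 hS).2]
      congr 2; omega

/-- `g r A` is the sum of the principal minors of `A` of size `r`. -/
theorem g_eq_sum_det_principalSubmatrix {n r : ℕ} (hrn : r ≤ n) (A : Matrix (Fin n) (Fin n) ℂ) :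
    g r A = ∑ I : Q r n, (principalSubmatrix A I).det := by
  have h := A.charpoly_coeff_card_sub (r := r) (by simpa using hrn)
  rw [Fintype.card_fin] at h
  rw [g, h, ← mul_assoc, ← mul_pow, neg_one_mul, neg_neg, one_pow, one_mul]
  symm
  -- An increasing tuple corresponds to its range, an `r`-subset to its increasing enumeration.
  refine sum_bij' (fun I _ => univ.map I.toEmbedding)
    (fun T hT => T.orderEmbOfFin (mem_powersetCard.1 hT).2) ?_ ?_ ?_ ?_ ?_
  · intro I _
    simp [mem_powersetCard]
  · simp
  · intro I _
    exact (orderEmbOfFin_unique' _ (by simp)).symm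
  · intro T hT
    ext i
    simp
  · intro I _
    let e : Fin r ≃ {i // i ∈ univ.map I.toEmbedding} :=
      Equiv.ofBijective (fun a => ⟨I a, by simp⟩)
        ⟨fun a b hab => I.injective (congrArg Subtype.val hab), fun ⟨i, hi⟩ => by
          obtain ⟨a, -, ha⟩ := mem_map.1 hi
          exact ⟨a, Subtype.ext ha⟩⟩
    exact det_submatrix_equiv_self e
      (A.submatrix ((↑) : {i // i ∈ univ.map I.toEmbedding} → Fin n) (↑))

end CharCoeff

theorem corollary3p1 (n r : ℕ) (hr1 : 1 ≤ r) (hrn : r ≤ n)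
    (A X : Matrix (Fin n) (Fin n) ℂ) :
    ‖CharCoeff.g r (A + X) - CharCoeff.g r A‖ ≤
      ∑ I : CharCoeff.Q r n, ∑ k ∈ Finset.Icc 1 r,
        CharCoeff.p (r - k) (CharCoeff.s (CharCoeff.principalSubmatrix A I)) * ‖X‖ ^ k := by

  rw [CharCoeff.g_eq_sum_det_principalSubmatrix hrn, CharCoeff.g_eq_sum_det_principalSubmatrix hrn,
    ← Finset.sum_sub_distrib]
  refine norm_sum_le_of_le _ fun I _ => ?_
  refine (CharCoeff.norm_det_add_sub_det_le (CharCoeff.principalSubmatrix A I)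
    (CharCoeff.principalSubmatrix X I)).trans (Finset.sum_le_sum fun k _ => ?_)
  refine mul_le_mul_of_nonneg_left (pow_le_pow_left₀ (norm_nonneg _)
    (Matrix.l2_opNorm_submatrix_le X I.injective) k) ?_
  rw [CharCoeff.p_eq_sum_prod]
  exact Finset.sum_nonneg fun S _ => Finset.prod_nonneg fun i _ => CharCoeff.s_nonneg _ i
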